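/- Let $n\ge 2$. For $\alpha\in\mathbb{R}$ put $\mu(x)=|x|^{\alpha}$ and $\mathbb{A}(x)=\mu(x)\mathbb{I}_n$ for $x\in\mathbb{R}^n$, where $\mathbb{I}_n$ is the $n\times n$ identity matrix. For $R_0>0$, $\Omega\subset\mathbb{R}^n$, an almost everywhere positive weight $\sigma\in L^1_{\mathrm{loc}}(\mathbb{R}^n)$ and a matrix function $\mathbb{M}=(m_{ij})$ on $\mathbb{R}^n$ with locally integrable entries let $$[\mathbb{M}]^2_{\mathrm{BMO}_{R_0}(\Omega,\sigma)}=\sum_{i,j=1}^n\ \sup_{x\in\Omega,\ 0<\rho<R_0}\ \frac{1}{\sigma(B_\rho(x))}\int_{B_\rho(x)}\big|m_{ij}(y)-\langle m_{ij}\rangle_{B_\rho(x)}\big|^2\,\sigma(y)^{-1}\,dy\in[0,\infty],$$ where $\sigma(B)=\int_B\sigma\,dy$ and $\langle m\rangle_B=\frac1{|B|}\int_B m\,dy$. Then: 1. There is a constant $C=C(n)>0$ such that for all $\alpha$ with $|\alpha|\le 1$ the entries of $\mathbb{A}$ are locally integrable and $[\mathbb{A}]^2_{\mathrm{BMO}_{R_0}(B_1(0),\mu)}\le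 C(n)\,|\alpha|$ for every $R_0>0$. 2. For every $\delta>0$ there is $\alpha_0>0$ such that for all $\alpha$ with $|\alpha|<\alpha_0$ the weight $\mu$ belongs to the Muckenhoupt class $A_2$, i.e. $\sup_B\big(\frac1{|B|}\int_B\mu\,dy\big)\big(\frac1{|B|}\int_B\mu^{-1}\,dy\big)<\infty$ over all balls $B\subset\mathbb{R}^n$, and, for every $R_0>0$ and every $\Omega\subset\mathbb{R}^n$ (in particular $\Omega=B_1(0)$), $\mathbb{A}\in\mathcal{A}_{R_0}(\delta,\mu,1,\Omega)$. Here $\mathcal{A}_{R_0}(\delta,\mu,\Lambda,\Omega)$ is the class of measurable symmetric matrix functions $\mathbb{M}:\mathbb{R}^n\to\mathbb{R}^{n\times n}$ such that, for almost every $x$ and all $\xi\in\mathbb{R}^n$, $\Lambda\mu(x)|\xi|^2\le\langle\mathbb{M}(x)\xi,\xi\rangle\le\Lambda^{-1}\mu(x)|\xi|^2$, and $[\mathbb{M}]^2_{\mathrm{BMO}_{R_0}(\Omega,\mu)}<\delta$. 3. If $-1\le\alpha<0$, then $[\mathbb{A}]^2_{\mathrm{BMO}_{R_0}(B_1(0),1)}=\infty$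 for every $R_0>0$; in particular (with $R_0=\operatorname{diam}B_1(0)$) $\mathbb{A}$ is not in the classical space $\mathrm{BMO}(B_1(0))$, although the bound in 1 applies to it. -/

import Mathlib

open MeasureTheory Metric
open scoped ENNReal Matrix

noncomputable section

/-- The squared mean oscillation of `f` on the ball `B_ρ(x)` relative to the weight `μ`,
`μ(B)⁻¹ ∫_B |f - ⟨f⟩_B|² μ⁻¹ dy`, where `⟨f⟩_B` is the average with respect to Lebesgue measure
and `μ(B) = ∫_B μ dy`. It takes values in `[0, ∞]`; it is meant for a locally integrable `f` and
a locally integrable weight `μ` which is positive almost everywhere. -/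
def weightedOscSq {n : ℕ} (μ f : EuclideanSpace ℝ (Fin n) → ℝ)
    (x : EuclideanSpace ℝ (Fin n)) (ρ : ℝ) : ℝ≥0∞ :=
  (∫⁻ y in ball x ρ, ENNReal.ofReal (|f y - ⨍ z in ball x ρ, f z| ^ 2) / ENNReal.ofReal (μ y)) /
    ∫⁻ y in ball x ρ, ENNReal.ofReal (μ y)

/-- `[f]²` in `BMO_{R₀}(Ω, μ)`: the supremum of the squared weighted mean oscillations over all
balls with centre in `Ω` and radius in `(0, R₀)`. The balls need not lie in `Ω`. -/
def bmoSq {n : ℕ} (R₀ : ℝ) (Ω : Set (EuclideanSpace ℝ (Fin n)))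
    (μ f : EuclideanSpace ℝ (Fin n) → ℝ) : ℝ≥0∞ :=
  ⨆ (x : EuclideanSpace ℝ (Fin n)) (_ : x ∈ Ω) (ρ : ℝ) (_ : 0 < ρ) (_ : ρ < R₀),
    weightedOscSq μ f x ρ

/-- `[𝔸]²` in `BMO_{R₀}(Ω, μ)` for a matrix function: the sum over the entries. -/
def matrixBMOSq {n : ℕ} (R₀ : ℝ) (Ω : Set (EuclideanSpace ℝ (Fin n)))
    (μ : EuclideanSpace ℝ (Fin n) → ℝ)
    (A : EuclideanSpace ℝ (Fin n) → Matrix (Fin n) (Fin n) ℝ) : ℝ≥0∞ :=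
  ∑ i, ∑ j, bmoSq R₀ Ω μ (fun x => A x i j)

/-- The Muckenhoupt constant `[μ]_{A₂} = sup_B (⨍_B μ) (⨍_B μ⁻¹)`, with values in `[0, ∞]`. -/
def muckenhouptA2Const {n : ℕ} (μ : EuclideanSpace ℝ (Fin n) → ℝ) : ℝ≥0∞ :=
  ⨆ (x : EuclideanSpace ℝ (Fin n)) (r : ℝ) (_ : 0 < r),
    (⨍⁻ y in ball x r, ENNReal.ofReal (μ y) ∂volume) *
      ⨍⁻ y in ball x r, (ENNReal.ofReal (μ y))⁻¹ ∂volume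

/-- `μ ∈ A₂`: a locally integrable weight, positive almost everywhere, with `[μ]_{A₂} < ∞`. -/
structure IsMuckenhouptA2 {n : ℕ} (μ : EuclideanSpace ℝ (Fin n) → ℝ) : Prop where
  locallyIntegrable : LocallyIntegrable μ
  ae_pos : ∀ᵐ x, 0 < μ x
  const_lt_top : muckenhouptA2Const μ < ∞

/-- The class `𝒜_{R₀}(δ, μ, Λ, Ω)` of measurable symmetric matrix functions `𝔸` on `ℝⁿ` with
`Λ μ |ξ|² ≤ ⟨𝔸 ξ, ξ⟩ ≤ Λ⁻¹ μ |ξ|²` almost everywhere and `[𝔸]² < δ` in `BMO_{R₀}(Ω, μ)`. -/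
structure IsSmallOscCoeff {n : ℕ} (R₀ δ : ℝ) (μ : EuclideanSpace ℝ (Fin n) → ℝ) (Λ : ℝ)
    (Ω : Set (EuclideanSpace ℝ (Fin n)))
    (A : EuclideanSpace ℝ (Fin n) → Matrix (Fin n) (Fin n) ℝ) : Prop where
  measurable : ∀ i j, AEMeasurable (fun x => A x i j)
  symmetric : ∀ x, (A x).IsSymm
  elliptic : ∀ᵐ x, ∀ ξ : Fin n → ℝ,
    Λ * μ x * (ξ ⬝ᵥ ξ) ≤ (A x *ᵥ ξ) ⬝ᵥ ξ ∧ (A x *ᵥ ξ) ⬝ᵥ ξ ≤ Λ⁻¹ * μ x * (ξ ⬝ᵥ ξ)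
  bmo_lt : matrixBMOSq R₀ Ω μ A < ENNReal.ofReal δ

/-- The weight `|x|^α` on `ℝⁿ`. -/
def powerWeight (n : ℕ) (α : ℝ) : EuclideanSpace ℝ (Fin n) → ℝ := fun x => ‖x‖ ^ α

/-- The coefficient matrix `|x|^α Iₙ`. -/
def powerCoeff (n : ℕ) (α : ℝ) : EuclideanSpace ℝ (Fin n) → Matrix (Fin n) (Fin n) ℝ :=
  fun x => powerWeight n α x • (1 : Matrix (Fin n) (Fin n) ℝ)

end

/-! Expanding the square shows that the oscillation of a weight relative to itself on a ball is
exactly its `A₂` product there minus one (`weightedOscSq_self`). It therefore suffices that the `A₂`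
product of `|x|^α` is `1 + O(|α|)` uniformly over balls. Jensen bounds it by the `|α|`-th power of
the `A₂` product of `|x|`, which is at most some `K`, and Bernoulli gives `K ^ |α| ≤ 1 + K|α|`
(`exists_average_powerWeight_mul_le`). Without the weight there is no such cancellation: for `α < 0`
the oscillation on `B_r(0)` is at least a positive constant times `r ^ (2α)`, which blows up as `r →
0`. -/

/-! ### Local integrability of power weights -/

theorem integrableOn_norm_inv_ball_zero {n : ℕ} (hn : 2 ≤ n) (r : ℝ) :
    IntegrableOn (fun y : EuclideanSpace ℝ (Fin n) => ‖y‖⁻¹) (ball 0 r) := by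
  have : Nontrivial (EuclideanSpace ℝ (Fin n)) :=
    Module.nontrivial_of_finrank_pos (R := ℝ) (by simp; omega)
  rw [integrableOn_fun_norm_addHaar volume (f := fun t : ℝ => t⁻¹)]
  -- The polar Jacobian `y ^ (n - 1)` absorbs the singularity `y⁻¹` because `n ≥ 2`.
  have h : IntegrableOn (fun y : ℝ => y ^ (n - 2)) (Set.Ioo 0 r) :=
    (Continuous.integrableOn_Icc (by fun_prop)).mono_set Set.Ioo_subset_Icc_self
  refine h.congr_fun (fun y hy => ?_) measurableSet_Ioo
  have hy0 : y ≠ 0 := hy.1.ne'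
  obtain ⟨k, rfl⟩ := Nat.exists_eq_add_of_le hn
  simp only [finrank_euclideanSpace, Fintype.card_fin, smul_eq_mul]
  rw [show 2 + k - 2 = k by omega, show 2 + k - 1 = k + 1 by omega, pow_succ]
  field_simp

theorem integrableOn_norm_inv_ball {n : ℕ} (hn : 2 ≤ n) (x : EuclideanSpace ℝ (Fin n)) (r : ℝ) :
    IntegrableOn (fun y : EuclideanSpace ℝ (Fin n) => ‖y‖⁻¹) (ball x r) :=
  (integrableOn_norm_inv_ball_zero hn (r + dist x 0)).mono_set
    (ball_subset_ball' le_rfl)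

/-- A single integrable majorant for all exponents in `[-1, 1]`. The summand `1` also covers `t =
0`, where `0 ^ 0 = 1` and `0⁻¹ = 0`. -/
theorem Real.rpow_le_one_add_self_add_inv {t s : ℝ} (ht : 0 ≤ t) (hs : |s| ≤ 1) :
    t ^ s ≤ 1 + t + t⁻¹ := by
  obtain ⟨h1, h2⟩ := abs_le.1 hs
  have hti : 0 ≤ t⁻¹ := inv_nonneg.2 ht
  rcases ht.eq_or_lt with rfl | h0
  · have := Real.zero_rpow_le_one s
    simpa using this
  rcases le_total 1 t with h | h
  · have := Real.rpow_le_rpow_of_exponent_le h h2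
    rw [Real.rpow_one] at this
    linarith
  · have := Real.rpow_le_rpow_of_exponent_ge h0 h h1
    rw [Real.rpow_neg_one] at this
    linarith

theorem measurable_powerWeight (n : ℕ) (α : ℝ) : Measurable (powerWeight n α) := by
  unfold powerWeight
  fun_prop

theorem integrableOn_norm_ball {n : ℕ} (x : EuclideanSpace ℝ (Fin n)) (r : ℝ) :
    IntegrableOn (fun y : EuclideanSpace ℝ (Fin n) => ‖y‖) (ball x r) :=
  (continuous_norm.continuousOn.integrableOn_compact (isCompact_closedBall x r)).mono_set
    ball_subset_closedBall

theorem integrableOn_powerWeight_ball {n : ℕ} (hn : 2 ≤ n) {α : ℝ} (hα : |α| ≤ 1)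
    (x : EuclideanSpace ℝ (Fin n)) (r : ℝ) : IntegrableOn (powerWeight n α) (ball x r) := by
  have h1 : IntegrableOn (fun _ : EuclideanSpace ℝ (Fin n) => (1 : ℝ)) (ball x r) :=
    integrableOn_const measure_ball_lt_top.ne
  refine Integrable.mono' ((h1.add (integrableOn_norm_ball x r)).add
    (integrableOn_norm_inv_ball hn x r)) (measurable_powerWeight n α).aestronglyMeasurable
    (.of_forall fun y => ?_)
  rw [powerWeight, Real.norm_of_nonneg (Real.rpow_nonneg (norm_nonneg y) α)]
  exact Real.rpow_le_one_add_self_add_inv (norm_nonneg y) hα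

theorem locallyIntegrable_powerWeight {n : ℕ} (hn : 2 ≤ n) {α : ℝ} (hα : |α| ≤ 1) :
    LocallyIntegrable (powerWeight n α) := fun x =>
  ⟨ball x 1, ball_mem_nhds x one_pos, integrableOn_powerWeight_ball hn hα x 1⟩

theorem ae_powerWeight_pos {n : ℕ} (hn : 2 ≤ n) (α : ℝ) : ∀ᵐ x, 0 < powerWeight n α x := by
  have : Nontrivial (EuclideanSpace ℝ (Fin n)) :=
    Module.nontrivial_of_finrank_pos (R := ℝ) (by simp; omega)
  filter_upwards [Measure.ae_ne volume (0 : EuclideanSpace ℝ (Fin n))] with x hx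
  exact Real.rpow_pos_of_pos (norm_pos_iff.2 hx) α

theorem powerWeight_neg (n : ℕ) (α : ℝ) (y : EuclideanSpace ℝ (Fin n)) :
    powerWeight n (-α) y = (powerWeight n α y)⁻¹ :=
  Real.rpow_neg (norm_nonneg y) α

/-! ### The `A₂` product of `|x|^α` -/

theorem setIntegral_norm_inv_ball_zero {n : ℕ} {r : ℝ} (hr : 0 < r) :
    ∫ y in ball (0 : EuclideanSpace ℝ (Fin n)) r, ‖y‖⁻¹ =
      r ^ n * r⁻¹ * ∫ y in ball (0 : EuclideanSpace ℝ (Fin n)) 1, ‖y‖⁻¹ := by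
  have h := Measure.setIntegral_comp_smul_of_pos (volume : Measure (EuclideanSpace ℝ (Fin n)))
    (fun y => ‖y‖⁻¹) (ball 0 1) hr
  simp only [norm_smul, Real.norm_eq_abs, abs_of_pos hr, mul_inv, integral_const_mul,
    smul_unitBall_of_pos hr, finrank_euclideanSpace, Fintype.card_fin, smul_eq_mul] at h
  rw [mul_assoc, h, mul_inv_cancel_left₀ (by positivity)]

theorem volume_real_ball_eq {n : ℕ} (x : EuclideanSpace ℝ (Fin n)) {r : ℝ}
    (hr : 0 < r) : volume.real (ball x r) =
      r ^ n * volume.real (ball (0 : EuclideanSpace ℝ (Fin n)) 1) := by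
  rw [measureReal_def, measureReal_def, Measure.addHaar_ball_of_pos _ _ hr, ENNReal.toReal_mul,
    ENNReal.toReal_ofReal (by positivity)]
  simp

theorem volume_real_ball_pos {n : ℕ} (x : EuclideanSpace ℝ (Fin n)) {r : ℝ}
    (hr : 0 < r) : 0 < volume.real (ball x r) :=
  ENNReal.toReal_pos (measure_ball_pos volume x hr).ne' measure_ball_lt_top.ne

theorem setAverage_le_of_forall_le {X : Type*} [MeasurableSpace X] {ν : Measure X} {s : Set X}
    (hs : MeasurableSet s) (h0 : 0 < ν.real s) (ht : ν s ≠ ∞) {f : X → ℝ} {c : ℝ}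
    (hf : IntegrableOn f s ν) (h : ∀ y ∈ s, f y ≤ c) : ⨍ y in s, f y ∂ν ≤ c := by
  rw [setAverage_eq, smul_eq_mul, inv_mul_le_iff₀ h0]
  refine (setIntegral_mono_on hf (integrableOn_const ht) hs h).trans ?_
  simp

/-- The `A₂` constant of `|x|` is finite. -/
theorem exists_average_norm_mul_average_norm_inv_le {n : ℕ} (hn : 2 ≤ n) :
    ∃ K : ℝ, 1 ≤ K ∧ ∀ (x : EuclideanSpace ℝ (Fin n)) (r : ℝ), 0 < r →
      (⨍ y in ball x r, ‖y‖) * (⨍ y in ball x r, ‖y‖⁻¹) ≤ K := by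
  set I : ℝ := ∫ y in ball (0 : EuclideanSpace ℝ (Fin n)) 1, ‖y‖⁻¹ with hI
  set V : ℝ := volume.real (ball (0 : EuclideanSpace ℝ (Fin n)) 1) with hV
  have hI0 : 0 ≤ I := integral_nonneg fun y => by positivity
  have hV0 : 0 < V := volume_real_ball_pos 0 one_pos
  have hK : 0 ≤ 3 ^ n * I / V := by positivity
  refine ⟨3 + 3 ^ n * I / V, by linarith, fun x r hr => ?_⟩
  have hB : 0 < volume.real (ball x r) := volume_real_ball_pos x hr
  have hB' : volume (ball x r) ≠ ∞ := measure_ball_lt_top.ne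
  have hinv0 : 0 ≤ ⨍ y in ball x r, ‖y‖⁻¹ := by
    rw [setAverage_eq]
    exact smul_nonneg (by positivity) (integral_nonneg fun y => by positivity)
  -- Far from the origin `‖y‖` is comparable to `‖x‖` on the ball. Otherwise the ball lies in
  -- `B_{3r}(0)`, and scaling reduces to the unit ball.
  rcases le_total (2 * r) ‖x‖ with h | h
  · have hx : 0 < ‖x‖ := by linarith
    have h1 : ⨍ y in ball x r, ‖y‖ ≤ 3 / 2 * ‖x‖ := by
      refine setAverage_le_of_forall_le measurableSet_ball hB hB' (integrableOn_norm_ball x r)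
        fun y hy => ?_
      have := norm_sub_norm_le y x
      have := mem_ball_iff_norm.1 hy
      linarith
    have h2 : ⨍ y in ball x r, ‖y‖⁻¹ ≤ (‖x‖ / 2)⁻¹ := by
      refine setAverage_le_of_forall_le measurableSet_ball hB hB' (integrableOn_norm_inv_ball hn x r)
        fun y hy => ?_
      have := norm_sub_norm_le x y
      have := mem_ball_iff_norm'.1 hy
      exact inv_anti₀ (by positivity) (by linarith)
    calc _ ≤ 3 / 2 * ‖x‖ * (‖x‖ / 2)⁻¹ := mul_le_mul h1 h2 hinv0 (by positivity)
      _ = 3 := by field_simp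
      _ ≤ _ := by linarith
  · have h1 : ⨍ y in ball x r, ‖y‖ ≤ 3 * r := by
      refine setAverage_le_of_forall_le measurableSet_ball hB hB' (integrableOn_norm_ball x r)
        fun y hy => ?_
      have := norm_sub_norm_le y x
      have := mem_ball_iff_norm.1 hy
      linarith
    have h2 : ∫ y in ball x r, ‖y‖⁻¹ ≤ (3 * r) ^ n * (3 * r)⁻¹ * I := by
      rw [hI, ← setIntegral_norm_inv_ball_zero (by positivity : 0 < 3 * r)]
      refine setIntegral_mono_set (integrableOn_norm_inv_ball_zero hn _)
        (.of_forall fun y => by positivity) (LE.le.eventuallyLE ?_)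
      exact ball_subset_ball' (by rw [dist_zero_right]; linarith)
    have h3 : ⨍ y in ball x r, ‖y‖⁻¹ ≤ 3 ^ n * (3 * r)⁻¹ * I / V := by
      rw [setAverage_eq, smul_eq_mul, inv_mul_le_iff₀ hB, volume_real_ball_eq x hr, ← hV]
      refine h2.trans (le_of_eq ?_)
      rw [mul_pow]
      field_simp
    calc _ ≤ 3 * r * (3 ^ n * (3 * r)⁻¹ * I / V) := mul_le_mul h1 h3 hinv0 (by positivity)
      _ = 3 ^ n * I / V := by field_simp
      _ ≤ _ := by linarith

theorem average_rpow_le_rpow_average {X : Type*} [MeasurableSpace X] {ν : Measure X} {s : Set X}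
    (h0 : ν s ≠ 0) (ht : ν s ≠ ∞) {f : X → ℝ} {p : ℝ} (hp0 : 0 ≤ p) (hp1 : p ≤ 1)
    (hf0 : ∀ y, 0 ≤ f y) (hf : IntegrableOn f s ν) (hfp : IntegrableOn (fun y => f y ^ p) s ν) :
    ⨍ y in s, f y ^ p ∂ν ≤ (⨍ y in s, f y ∂ν) ^ p :=
  ConcaveOn.le_map_set_average (Real.concaveOn_rpow hp0 hp1)
    (Real.continuous_rpow_const hp0).continuousOn isClosed_Ici h0 ht
    (.of_forall fun y => hf0 y) hf hfp

theorem setAverage_nonneg_of_forall {X : Type*} [MeasurableSpace X] {ν : Measure X} {s : Set X}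
    {f : X → ℝ} (hf : ∀ y, 0 ≤ f y) : 0 ≤ ⨍ y in s, f y ∂ν := by
  rw [setAverage_eq]
  exact smul_nonneg (by positivity) (integral_nonneg hf)

theorem powerWeight_nonneg (n : ℕ) (α : ℝ) (y : EuclideanSpace ℝ (Fin n)) :
    0 ≤ powerWeight n α y := Real.rpow_nonneg (norm_nonneg y) α

/-- Jensen for the concave map `t ↦ t ^ α`, applied to `‖y‖` and to `‖y‖⁻¹` separately. -/
theorem average_powerWeight_mul_le_of_nonneg {n : ℕ} (hn : 2 ≤ n) {α : ℝ} (hα0 : 0 ≤ α)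
    (hα1 : α ≤ 1) (x : EuclideanSpace ℝ (Fin n)) {r : ℝ} (hr : 0 < r) :
    (⨍ y in ball x r, powerWeight n α y) * (⨍ y in ball x r, powerWeight n (-α) y) ≤
      ((⨍ y in ball x r, ‖y‖) * (⨍ y in ball x r, ‖y‖⁻¹)) ^ α := by
  have hα : |α| ≤ 1 := abs_le.2 ⟨by linarith, hα1⟩
  have h0 := (measure_ball_pos volume x hr).ne'
  have ht : volume (ball x r) ≠ ∞ := measure_ball_lt_top.ne
  have e (y : EuclideanSpace ℝ (Fin n)) : powerWeight n (-α) y = (‖y‖⁻¹) ^ α := by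
    rw [powerWeight, Real.rpow_neg (norm_nonneg y), Real.inv_rpow (norm_nonneg y)]
  rw [Real.mul_rpow (setAverage_nonneg_of_forall fun y => norm_nonneg y)
    (setAverage_nonneg_of_forall fun y => inv_nonneg.2 (norm_nonneg y))]
  refine mul_le_mul ?_ ?_ (setAverage_nonneg_of_forall (powerWeight_nonneg n _))
    (Real.rpow_nonneg (setAverage_nonneg_of_forall fun y => norm_nonneg y) _)
  · exact average_rpow_le_rpow_average h0 ht hα0 hα1 (fun y => norm_nonneg y)
      (integrableOn_norm_ball x r) (integrableOn_powerWeight_ball hn hα x r)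
  · have h := integrableOn_powerWeight_ball hn (α := -α) (by rwa [abs_neg]) x r
    simp only [e]
    exact average_rpow_le_rpow_average h0 ht hα0 hα1 (fun y => inv_nonneg.2 (norm_nonneg y))
      (integrableOn_norm_inv_ball hn x r) (by simpa only [← e] using h)

/-- The excess over `1` has to vanish linearly in `α`; Bernoulli's inequality supplies this. The
product is symmetric under `α ↦ -α`, so nonnegative exponents suffice. -/
theorem exists_average_powerWeight_mul_le {n : ℕ} (hn : 2 ≤ n) :
    ∃ K : ℝ, 0 < K ∧ ∀ α : ℝ, |α| ≤ 1 → ∀ (x : EuclideanSpace ℝ (Fin n)) (r : ℝ), 0 < r →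
      (⨍ y in ball x r, powerWeight n α y) * (⨍ y in ball x r, powerWeight n (-α) y) ≤
        1 + K * |α| := by
  obtain ⟨K, hK1, hK⟩ := exists_average_norm_mul_average_norm_inv_le hn
  refine ⟨K, by linarith, fun α hα x r hr => ?_⟩
  have key : ((⨍ y in ball x r, ‖y‖) * (⨍ y in ball x r, ‖y‖⁻¹)) ^ |α| ≤ 1 + K * |α| := by
    calc _ ≤ K ^ |α| := Real.rpow_le_rpow (mul_nonneg (setAverage_nonneg_of_forall fun y => norm_nonneg y)
          (setAverage_nonneg_of_forall fun y => inv_nonneg.2 (norm_nonneg y))) (hK x r hr) (abs_nonneg α)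
      _ = (1 + (K - 1)) ^ |α| := by ring_nf
      _ ≤ 1 + |α| * (K - 1) := rpow_one_add_le_one_add_mul_self (by linarith) (abs_nonneg α) hα
      _ ≤ 1 + K * |α| := by nlinarith [abs_nonneg α]
  refine le_trans ?_ key
  rcases abs_cases α with ⟨h, h'⟩ | ⟨h, h'⟩
  · rw [h] at hα ⊢
    exact average_powerWeight_mul_le_of_nonneg hn h' hα x hr
  · rw [h] at hα ⊢
    have := average_powerWeight_mul_le_of_nonneg hn (α := -α) (by linarith) hα x hr
    rwa [neg_neg, mul_comm] at this

/-! ### Weighted oscillation and membership in `A₂` -/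

/-- Expanding the square, the weighted oscillation of a weight relative to itself is
its `A₂` product on the same ball minus one. -/
theorem weightedOscSq_self {n : ℕ} {μ : EuclideanSpace ℝ (Fin n) → ℝ}
    {x : EuclideanSpace ℝ (Fin n)} {r : ℝ} (hr : 0 < r) (hpos : ∀ᵐ y, 0 < μ y)
    (hμ : IntegrableOn μ (ball x r)) (hμ' : IntegrableOn (fun y => (μ y)⁻¹) (ball x r)) :
    weightedOscSq μ μ x r =
      ENNReal.ofReal ((⨍ y in ball x r, μ y) * (⨍ y in ball x r, (μ y)⁻¹) - 1) := by
  set B := ball x r with hB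
  set m := ⨍ y in B, μ y with hm
  have hV : 0 < volume.real B := volume_real_ball_pos x hr
  have hpos' : ∀ᵐ y ∂volume.restrict B, 0 < μ y := ae_restrict_of_ae hpos
  have hI : 0 < ∫ y in B, μ y := by
    rw [setIntegral_pos_iff_support_of_nonneg_ae (hpos'.mono fun y hy => hy.le) hμ]
    have : volume (Function.support μ ∩ B) = volume B := by
      refine measure_congr ?_
      filter_upwards [hpos] with y hy
      refine propext ⟨fun h => h.2, fun h => ⟨hy.ne', h⟩⟩
    rw [this]
    exact measure_ball_pos volume x hr
  have hden : ∫⁻ y in B, ENNReal.ofReal (μ y) = ENNReal.ofReal (∫ y in B, μ y) :=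
    (ofReal_integral_eq_lintegral_ofReal hμ (hpos'.mono fun y hy => hy.le)).symm
  have hint : IntegrableOn (fun y => μ y - 2 * m + m ^ 2 * (μ y)⁻¹) B :=
    (hμ.sub (integrableOn_const measure_ball_lt_top.ne)).add (hμ'.const_mul _)
  have hsq : ∀ᵐ y ∂volume.restrict B,
      |μ y - m| ^ 2 / μ y = μ y - 2 * m + m ^ 2 * (μ y)⁻¹ := by
    filter_upwards [hpos'] with y hy
    rw [sq_abs]
    field_simp
    ring
  have hnum : ∫⁻ y in B, ENNReal.ofReal (|μ y - m| ^ 2) / ENNReal.ofReal (μ y) =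
      ENNReal.ofReal (∫ y in B, (μ y - 2 * m + m ^ 2 * (μ y)⁻¹)) := by
    rw [ofReal_integral_eq_lintegral_ofReal hint]
    · refine lintegral_congr_ae ?_
      filter_upwards [hpos', hsq] with y hy h
      rw [← ENNReal.ofReal_div_of_pos hy, h]
    · filter_upwards [hpos', hsq] with y hy h
      rw [← h]
      exact div_nonneg (sq_nonneg _) hy.le
  have hval : ∫ y in B, (μ y - 2 * m + m ^ 2 * (μ y)⁻¹) =
      (∫ y in B, μ y) - volume.real B * (2 * m) + m ^ 2 * ∫ y in B, (μ y)⁻¹ := by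
    rw [integral_add (f := fun y => μ y - 2 * m)
        (hμ.sub (integrableOn_const measure_ball_lt_top.ne)) (hμ'.const_mul _),
      integral_sub hμ (integrableOn_const measure_ball_lt_top.ne), setIntegral_const, smul_eq_mul,
      integral_const_mul]
  rw [weightedOscSq, ← hB, ← hm, hnum, hden, ← ENNReal.ofReal_div_of_pos hI, hval]
  congr 1
  -- Since `|B| m = ∫ μ`, the three terms divided by `∫ μ` are `1`, `-2` and `m ⨍ μ⁻¹`.
  rw [setAverage_eq, hm, setAverage_eq, smul_eq_mul, smul_eq_mul]
  field_simp
  ring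

theorem weightedOscSq_powerWeight {n : ℕ} (hn : 2 ≤ n) {α : ℝ} (hα : |α| ≤ 1)
    (x : EuclideanSpace ℝ (Fin n)) {r : ℝ} (hr : 0 < r) :
    weightedOscSq (powerWeight n α) (powerWeight n α) x r =
      ENNReal.ofReal ((⨍ y in ball x r, powerWeight n α y) *
        (⨍ y in ball x r, powerWeight n (-α) y) - 1) := by
  have h := integrableOn_powerWeight_ball hn (α := -α) (by rwa [abs_neg]) x r
  simp only [powerWeight_neg]
  exact weightedOscSq_self hr (ae_powerWeight_pos hn α) (integrableOn_powerWeight_ball hn hα x r)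
    (by simpa only [← powerWeight_neg] using h)

theorem weightedOscSq_zero {n : ℕ} (μ : EuclideanSpace ℝ (Fin n) → ℝ)
    (x : EuclideanSpace ℝ (Fin n)) (r : ℝ) : weightedOscSq μ (fun _ => 0) x r = 0 := by
  simp [weightedOscSq]

theorem powerCoeff_apply_self (n : ℕ) (α : ℝ) (i : Fin n) :
    (fun x => powerCoeff n α x i i) = powerWeight n α := by
  ext x
  simp [powerCoeff]

theorem powerCoeff_apply_ne (n : ℕ) (α : ℝ) {i j : Fin n} (h : i ≠ j) :
    (fun x => powerCoeff n α x i j) = fun _ => 0 := by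
  ext x
  simp [powerCoeff, h]

theorem matrixBMOSq_powerCoeff_le {n : ℕ} {α R₀ c : ℝ} {Ω : Set (EuclideanSpace ℝ (Fin n))}
    (h : ∀ x r, 0 < r →
      weightedOscSq (powerWeight n α) (powerWeight n α) x r ≤ ENNReal.ofReal c) :
    matrixBMOSq R₀ Ω (powerWeight n α) (powerCoeff n α) ≤ ENNReal.ofReal (n * n * c) := by
  -- Off-diagonal entries contribute `0`; bounding them by `c` as well only costs a dimensional
  -- factor.
  have hij (i j : Fin n) : bmoSq R₀ Ω (powerWeight n α) (fun x => powerCoeff n α x i j) ≤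
      ENNReal.ofReal c := by
    refine iSup₂_le fun x _ => iSup₂_le fun r hr => iSup_le fun _ => ?_
    rcases eq_or_ne i j with rfl | hne
    · rw [powerCoeff_apply_self]
      exact h x r hr
    · rw [powerCoeff_apply_ne n α hne, weightedOscSq_zero]
      exact zero_le
  calc _ ≤ ∑ _i : Fin n, ∑ _j : Fin n, ENNReal.ofReal c :=
        Finset.sum_le_sum fun i _ => Finset.sum_le_sum fun j _ => hij i j
    _ = _ := by
        simp only [Finset.sum_const, Finset.card_univ, Fintype.card_fin, nsmul_eq_mul]
        rw [ENNReal.ofReal_mul (by positivity), ENNReal.ofReal_mul (by positivity),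
          ENNReal.ofReal_natCast, mul_assoc]

theorem exists_matrixBMOSq_powerCoeff_le {n : ℕ} (hn : 2 ≤ n) :
    ∃ C : ℝ, 0 < C ∧ ∀ α : ℝ, |α| ≤ 1 → ∀ (R₀ : ℝ) (Ω : Set (EuclideanSpace ℝ (Fin n))),
      matrixBMOSq R₀ Ω (powerWeight n α) (powerCoeff n α) ≤ ENNReal.ofReal (C * |α|) := by
  obtain ⟨K, hK0, hK⟩ := exists_average_powerWeight_mul_le hn
  have hn0 : (0 : ℝ) < n := by exact_mod_cast (by omega : 0 < n)
  refine ⟨n * n * K, by positivity, fun α hα R₀ Ω => ?_⟩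
  rw [mul_assoc _ K]
  refine matrixBMOSq_powerCoeff_le fun x r hr => ?_
  rw [weightedOscSq_powerWeight hn hα x hr]
  exact ENNReal.ofReal_le_ofReal (by linarith [hK α hα x r hr])

theorem isMuckenhouptA2_powerWeight {n : ℕ} (hn : 2 ≤ n) {α : ℝ} (hα : |α| ≤ 1) :
    IsMuckenhouptA2 (powerWeight n α) := by
  refine ⟨locallyIntegrable_powerWeight hn hα, ae_powerWeight_pos hn α, ?_⟩
  obtain ⟨K, -, hK⟩ := exists_average_powerWeight_mul_le hn
  refine lt_of_le_of_lt (b := ENNReal.ofReal (1 + K * |α|)) ?_ ENNReal.ofReal_lt_top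
  refine iSup₂_le fun x r => iSup_le fun hr => ?_
  have havg {β : ℝ} (hβ : |β| ≤ 1) : ⨍⁻ y in ball x r, ENNReal.ofReal (powerWeight n β y) ∂volume =
      ENNReal.ofReal (⨍ y in ball x r, powerWeight n β y) := by
    rw [ofReal_setAverage (integrableOn_powerWeight_ball hn hβ x r)
      (.of_forall (powerWeight_nonneg n β)), setLAverage_eq]
  have hinv : ⨍⁻ y in ball x r, (ENNReal.ofReal (powerWeight n α y))⁻¹ ∂volume =
      ⨍⁻ y in ball x r, ENNReal.ofReal (powerWeight n (-α) y) ∂volume := by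
    refine laverage_congr (ae_restrict_of_ae ?_)
    filter_upwards [ae_powerWeight_pos hn α] with y hy
    rw [powerWeight_neg, ENNReal.ofReal_inv_of_pos hy]
  rw [hinv, havg hα, havg (by rwa [abs_neg]),
    ← ENNReal.ofReal_mul (setAverage_nonneg_of_forall (powerWeight_nonneg n α))]
  exact ENNReal.ofReal_le_ofReal (hK α hα x r hr)

/-! ### Blow-up of the unweighted oscillation -/

/-- If `f ≥ a` on one ball and `f ≤ b < a` on another ball of the same radius, both inside a given
ball, then the unweighted oscillation on the large ball is at least of order `(a - b)²`. -/
theorem le_weightedOscSq_one {n : ℕ} {f : EuclideanSpace ℝ (Fin n) → ℝ}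
    {x y z : EuclideanSpace ℝ (Fin n)} {r a b : ℝ} (hr : 0 < r) (hab : b ≤ a)
    (hy : ball y (r / 4) ⊆ ball x r) (hz : ball z (r / 4) ⊆ ball x r)
    (ha : ∀ᵐ w, w ∈ ball y (r / 4) → a ≤ f w) (hb : ∀ w ∈ ball z (r / 4), f w ≤ b) :
    ENNReal.ofReal (((a - b) / 2) ^ 2 / 4 ^ n) ≤ weightedOscSq (fun _ => 1) f x r := by
  -- Only the fact that `m` is a number matters, so `f` need not be integrable.
  set m := ⨍ w in ball x r, f w with hm
  have hvol (p : EuclideanSpace ℝ (Fin n)) :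
      volume (ball p (r / 4)) = ENNReal.ofReal (1 / 4 ^ n) * volume (ball x r) := by
    rw [Measure.addHaar_ball_of_pos _ _ (by positivity : 0 < r / 4),
      Measure.addHaar_ball_of_pos _ _ hr, ← mul_assoc, ← ENNReal.ofReal_mul (by positivity)]
    congr 2
    simp only [finrank_euclideanSpace, Fintype.card_fin, div_pow]
    ring
  have step (p : EuclideanSpace ℝ (Fin n)) (hp : ball p (r / 4) ⊆ ball x r)
      (h : ∀ᵐ w, w ∈ ball p (r / 4) → (a - b) / 2 ≤ |f w - m|) :
      ENNReal.ofReal (((a - b) / 2) ^ 2 / 4 ^ n) ≤ weightedOscSq (fun _ => 1) f x r := by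
    simp only [weightedOscSq, ENNReal.ofReal_one, div_one, lintegral_one,
      Measure.restrict_apply_univ, ← hm]
    rw [ENNReal.le_div_iff_mul_le (.inl (measure_ball_pos volume x hr).ne')
      (.inl measure_ball_lt_top.ne)]
    calc _ = ∫⁻ _ in ball p (r / 4), ENNReal.ofReal (((a - b) / 2) ^ 2) := by
          rw [setLIntegral_const, hvol, ← mul_assoc, ← ENNReal.ofReal_mul (by positivity)]
          congr 2
          ring
      _ ≤ ∫⁻ w in ball p (r / 4), ENNReal.ofReal (|f w - m| ^ 2) := by
          refine lintegral_mono_ae ((ae_restrict_iff' measurableSet_ball).2 ?_)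
          filter_upwards [h] with w hw hwp
          exact ENNReal.ofReal_le_ofReal
            (pow_le_pow_left₀ (by linarith) (hw hwp) 2)
      _ ≤ _ := lintegral_mono_set hp
  -- Whichever side of the midpoint `m` lies on, one of the small balls keeps `f` at distance at
  -- least `(a - b) / 2` from it.
  rcases le_total m ((a + b) / 2) with h | h
  · refine step y hy ?_
    filter_upwards [ha] with w hw hwp
    exact le_trans (by linarith [hw hwp]) (le_abs_self _)
  · refine step z hz (.of_forall fun w hw => ?_)
    rw [abs_sub_comm]
    exact le_trans (by linarith [hb w hw]) (le_abs_self _)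

theorem le_weightedOscSq_one_powerWeight {n : ℕ} (hn : 2 ≤ n) {α : ℝ} (hα : α < 0) {r : ℝ}
    (hr : 0 < r) :
    ENNReal.ofReal (r ^ (2 * α) * (((1 / 4) ^ α - (1 / 2) ^ α) / 2) ^ 2 / 4 ^ n) ≤
      weightedOscSq (fun _ => 1) (powerWeight n α) 0 r := by
  obtain ⟨e, he⟩ : ∃ e : EuclideanSpace ℝ (Fin n), ‖e‖ = 1 := by
    have : Nontrivial (EuclideanSpace ℝ (Fin n)) :=
      Module.nontrivial_of_finrank_pos (R := ℝ) (by simp; omega)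
    exact exists_norm_eq _ zero_le_one
  -- The ball of radius `r / 4` about `z` stays within `r / 2 < ‖w‖ < r`.
  set z : EuclideanSpace ℝ (Fin n) := (3 / 4 * r) • e with hz
  have hzn : ‖z‖ = 3 / 4 * r := by
    rw [hz, norm_smul, he, mul_one, Real.norm_of_nonneg (by positivity)]
  have key := le_weightedOscSq_one (f := powerWeight n α) (x := 0) (y := 0) (z := z)
    (a := (r * (1 / 4)) ^ α) (b := (r * (1 / 2)) ^ α) hr
    (Real.rpow_le_rpow_of_nonpos (by positivity) (by linarith) hα.le)
    (ball_subset_ball (by linarith))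
    (ball_subset_ball' (by rw [dist_zero_right, hzn]; linarith))
    (by
      -- The origin must be discarded, since `0 ^ α = 0` there.
      filter_upwards [ae_powerWeight_pos hn (1 : ℝ)] with w hw hwr
      rw [powerWeight, Real.rpow_one] at hw
      rw [mem_ball_zero_iff] at hwr
      exact Real.rpow_le_rpow_of_nonpos hw (by linarith) hα.le)
    (fun w hw => by
      have h1 := norm_sub_norm_le z w
      have h2 := mem_ball_iff_norm'.1 hw
      exact Real.rpow_le_rpow_of_nonpos (by positivity) (by linarith) hα.le)
  refine le_trans (le_of_eq ?_) key
  rw [Real.mul_rpow hr.le (by norm_num), Real.mul_rpow hr.le (by norm_num), two_mul,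
    Real.rpow_add hr]
  congr 1
  ring

theorem bmoSq_one_powerWeight {n : ℕ} (hn : 2 ≤ n) {α : ℝ} (hα : α < 0) {R₀ : ℝ} (hR : 0 < R₀) :
    bmoSq R₀ (ball 0 1) (fun _ => 1) (powerWeight n α) = ∞ := by
  set c : ℝ := (((1 / 4) ^ α - (1 / 2) ^ α) / 2) ^ 2 / 4 ^ n with hc
  have hc0 : 0 < c := by
    have : (1 / 2 : ℝ) ^ α < (1 / 4) ^ α :=
      Real.rpow_lt_rpow_of_neg (by norm_num) (by norm_num) hα
    have : 0 < ((1 / 4 : ℝ) ^ α - (1 / 2) ^ α) / 2 := by linarith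
    positivity
  have htop : Filter.Tendsto (fun r : ℝ => ENNReal.ofReal (r ^ (2 * α) * c))
      (nhdsWithin 0 (Set.Ioi 0)) (nhds ∞) :=
    ENNReal.tendsto_ofReal_nhds_top.2
      ((tendsto_rpow_neg_nhdsGT_zero (by linarith)).atTop_mul_const hc0)
  refine top_le_iff.1 (le_of_tendsto htop ?_)
  filter_upwards [Ioo_mem_nhdsGT hR] with r hr
  refine le_trans ?_ (le_iSup₂_of_le (0 : EuclideanSpace ℝ (Fin n)) (mem_ball_self one_pos)
    (le_iSup₂_of_le r hr.1 (le_iSup_of_le hr.2 le_rfl)))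
  rw [hc, ← mul_div_assoc]
  exact le_weightedOscSq_one_powerWeight hn hα hr.1

theorem isSmallOscCoeff_powerCoeff {n : ℕ} {α R₀ δ : ℝ} {Ω : Set (EuclideanSpace ℝ (Fin n))}
    (h : matrixBMOSq R₀ Ω (powerWeight n α) (powerCoeff n α) < ENNReal.ofReal δ) :
    IsSmallOscCoeff R₀ δ (powerWeight n α) 1 Ω (powerCoeff n α) where
  measurable i j := by
    rcases eq_or_ne i j with rfl | hne
    · rw [powerCoeff_apply_self]
      exact (measurable_powerWeight n α).aemeasurable
    · rw [powerCoeff_apply_ne n α hne]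
      exact aemeasurable_const
  symmetric x := by simp [powerCoeff, Matrix.IsSymm]
  elliptic := .of_forall fun x ξ => by simp [powerCoeff, Matrix.smul_mulVec]
  bmo_lt := h

theorem lemma2p9 (n : ℕ) (hn : 2 ≤ n) :
    -- the bound, uniformly in the maximal radius `R₀`
    (∃ C : ℝ, 0 < C ∧ ∀ α : ℝ, |α| ≤ 1 →
      (∀ i j, LocallyIntegrable (fun x => powerCoeff n α x i j)) ∧
      ∀ R₀ : ℝ, 0 < R₀ →
        matrixBMOSq R₀ (ball 0 1) (powerWeight n α) (powerCoeff n α) ≤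
          ENNReal.ofReal (C * |α|)) ∧
    -- smallness hypothesis for small exponents, on every set `Ω` and for every `R₀`
    (∀ δ : ℝ, 0 < δ → ∃ α₀ : ℝ, 0 < α₀ ∧ ∀ α : ℝ, |α| < α₀ →
      IsMuckenhouptA2 (powerWeight n α) ∧
      ∀ (R₀ : ℝ) (Ω : Set (EuclideanSpace ℝ (Fin n))), 0 < R₀ →
        IsSmallOscCoeff R₀ δ (powerWeight n α) 1 Ω (powerCoeff n α)) ∧
    -- for negative exponents the unweighted mean oscillation is infinite
    (∀ α : ℝ, -1 ≤ α → α < 0 → ∀ R₀ : ℝ, 0 < R₀ →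
      matrixBMOSq R₀ (ball (0 : EuclideanSpace ℝ (Fin n)) 1) (fun _ => 1) (powerCoeff n α) = ∞) := by
  obtain ⟨C, hC0, hC⟩ := exists_matrixBMOSq_powerCoeff_le hn
  refine ⟨⟨C, hC0, fun α hα => ⟨fun i j => ?_, fun R₀ _ => hC α hα R₀ _⟩⟩, fun δ hδ => ?_,
    fun α _ hα R₀ hR => ?_⟩
  · rcases eq_or_ne i j with rfl | hne
    · rw [powerCoeff_apply_self]
      exact locallyIntegrable_powerWeight hn hα
    · rw [powerCoeff_apply_ne n α hne]
      exact locallyIntegrable_zero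
  -- `1` keeps `α` in the range of the linear bound; `δ / C` makes that bound smaller than `δ`.
  · refine ⟨min 1 (δ / C), lt_min one_pos (div_pos hδ hC0), fun α hα => ?_⟩
    have hα1 : |α| ≤ 1 := hα.le.trans (min_le_left _ _)
    refine ⟨isMuckenhouptA2_powerWeight hn hα1, fun R₀ Ω _ => isSmallOscCoeff_powerCoeff ?_⟩
    refine (hC α hα1 R₀ Ω).trans_lt ((ENNReal.ofReal_lt_ofReal_iff hδ).2 ?_)
    have := hα.trans_le (min_le_right _ _)
    rwa [lt_div_iff₀' hC0] at this
  · refine ENNReal.sum_eq_top.2 ⟨⟨0, by omega⟩, Finset.mem_univ _, ?_⟩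
    refine ENNReal.sum_eq_top.2 ⟨⟨0, by omega⟩, Finset.mem_univ _, ?_⟩
    rw [powerCoeff_apply_self]
    exact bmoSq_one_powerWeight hn hα hR
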